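/- **Theorem C.** There exists a field $K$ with $\operatorname{char} K\neq 2$ such that 1. there are infinitely many pairwise non-isomorphic quaternion division algebras with center $K$ (that is, the set $\mathrm{Quat}^*(K)$ of $K$-isomorphism classes of quaternion division algebras with center $K$ is infinite), and 2. any two quaternion division algebras $D, D'$ with center $K$ are weakly isomorphic: every maximal subfield of $D$ is $K$-isomorphic to a maximal subfield of $D'$, and vice versa. Here a quaternion algebra with center $K$ is a $K$-algebra isomorphic to $\left(\frac{a,b}{K}\right)$ for some $a,b\in K^\times$, i.e. to the $4$-dimensional $K$-algebra with basis $1,i,j,ij$ and $i^2=a$, $j^2=b$, $ij=-ji$; and a maximal subfield of a division algebra $D$ with center $K$ is a maximal element of the poset of fields $E$ with $K\subseteq E\subseteq D$. -/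

import Mathlib

open scoped Quaternion

/-- `D` is a quaternion algebra over the field `K` (of characteristic not `2`): it is isomorphic, as
a `K`-algebra, to a Hilbert symbol `(a, b / K)` with `a, b ∈ Kˣ`, i.e. to the algebra with basis
`1, i, j, ij` and relations `i² = a`, `j² = b`, `ij = -ji`. -/
def IsQuaternionAlgebra (K D : Type*) [Field K] [Ring D] [Algebra K D] : Prop :=
  ∃ a b : K, a ≠ 0 ∧ b ≠ 0 ∧ Nonempty (D ≃ₐ[K] ℍ[K, a, b])

/-- A quaternion division algebra over `K`. -/
structure QuatDivAlg (K : Type) [Field K] where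
  carrier : Type
  [divisionRing : DivisionRing carrier]
  [algebra : Algebra K carrier]
  isQuaternionAlgebra : IsQuaternionAlgebra K carrier

attribute [instance] QuatDivAlg.divisionRing QuatDivAlg.algebra

instance (K : Type) [Field K] : CoeSort (QuatDivAlg K) Type := ⟨QuatDivAlg.carrier⟩

/-- Isomorphism of quaternion division algebras over `K`. -/
instance QuatDivAlg.isoSetoid (K : Type) [Field K] : Setoid (QuatDivAlg K) where
  r D D' := Nonempty (D ≃ₐ[K] D')
  iseqv :=
    { refl := fun _ => ⟨AlgEquiv.refl⟩
      symm := fun ⟨e⟩ => ⟨e.symm⟩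
      trans := fun ⟨e⟩ ⟨f⟩ => ⟨e.trans f⟩ }

/-- `Quat*(K)`: the set of isomorphism classes of quaternion division algebras over `K`. -/
def QuatStar (K : Type) [Field K] : Type 1 := Quotient (QuatDivAlg.isoSetoid K)

/-- `E` is a maximal subfield of the division `K`-algebra `D`: a maximal element of the poset of
fields `E` with `K ⊆ E ⊆ D`. -/
def IsMaximalSubfield (K : Type*) {D : Type*} [Field K] [DivisionRing D] [Algebra K D]
    (E : Subalgebra K D) : Prop :=
  Maximal (fun F : Subalgebra K D => IsField F) E

/-- `D` and `D'` are weakly isomorphic over `K`: the sets of `K`-isomorphism classes of their maximal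
subfields coincide. -/
def WeaklyIsomorphic (K D D' : Type*) [Field K] [DivisionRing D] [Algebra K D]
    [DivisionRing D'] [Algebra K D'] : Prop :=
  (∀ E : Subalgebra K D, IsMaximalSubfield K E →
    ∃ E' : Subalgebra K D', IsMaximalSubfield K E' ∧ Nonempty (E ≃ₐ[K] E')) ∧
  (∀ E' : Subalgebra K D', IsMaximalSubfield K E' →
    ∃ E : Subalgebra K D, IsMaximalSubfield K E ∧ Nonempty (E ≃ₐ[K] E'))

/-!
Let `K` have characteristic not `2` and let `d` be a non-square. The division algebra `(a, b / K)`
contains `√d` exactly when the quadric `a x² + b y² - ab z² = d` has a rational point, and passing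
to the function field of this quadric creates one. No quaternion division algebra `D = (A, B / K)`
is lost on the way: if `D` split over `K(v, y)(√f)` with `f = b - ab v² + ad y²`, then `f` would be
the square of a trace-zero element of `D` over `K(v, y)`. By Cassels–Pfister that element may be
taken of the form `P + Q y` with `P`, `Q` over `K(v)` anticommuting, `Q² = ad` and
`P² = b - ab v²`. Comparing `P` with an element over `K` that anticommutes with a square root of
`ad` shows that `b - ab v²` is, up to a constant, a norm from `K(v)(√(ad))`, and Cassels–Pfister
once more makes `d` a square.

Inside `ℂ` these extensions can be iterated countably often, starting from `ℚ`, until every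
non-square has a square root in every quaternion algebra. The algebras `(-1, p)` with `p ≡ 3 mod 4`
prime survive as division algebras, and they stay pairwise non-isomorphic because `(-1, pq)`
survives too.
-/

open Polynomial
open QuadraticMap (weightedSumSquares weightedSumSquares_apply polar)

section CasselsPfister

theorem map_smul_add_smul {R M : Type*} [CommRing R] [AddCommGroup M] [Module R M]
    (q : QuadraticForm R M) (a b : R) (v w : M) :
    q (a • v + b • w) = a ^ 2 * q v + a * b * polar q v w + b ^ 2 * q w := by
  rw [QuadraticMap.map_add q, QuadraticMap.map_smul, QuadraticMap.map_smul,
    QuadraticMap.polar_smul_left, QuadraticMap.polar_smul_right]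
  simp only [smul_eq_mul]
  ring

theorem weightedSumSquares_comp_algHom {K A B ι : Type*} [CommSemiring K] [CommSemiring A]
    [Algebra K A] [CommSemiring B] [Algebra K B] [Fintype ι] (φ : A →ₐ[K] B) (c : ι → K)
    (v : ι → A) : weightedSumSquares B c (φ ∘ v) = φ (weightedSumSquares A c v) := by
  simp only [weightedSumSquares_apply, Function.comp_apply, map_sum, map_smul, map_mul]

variable {K ι : Type*} [Field K] [Fintype ι] {c : ι → K}

theorem natDegree_weightedSumSquares_le {n : ℕ} {v : ι → K[X]} (hv : ∀ i, (v i).natDegree ≤ n) :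
    (weightedSumSquares K[X] c v).natDegree ≤ n + n := by
  rw [weightedSumSquares_apply]
  exact natDegree_sum_le_of_forall_le _ _ fun i _ =>
    (natDegree_smul_le _ _).trans (natDegree_mul_le_of_le (hv i) (hv i))

theorem coeff_weightedSumSquares {n : ℕ} {v : ι → K[X]} (hv : ∀ i, (v i).natDegree ≤ n) :
    (weightedSumSquares K[X] c v).coeff (n + n) =
      weightedSumSquares K c fun i => (v i).coeff n := by
  simp only [weightedSumSquares_apply, finsetSum_coeff, coeff_smul,
    coeff_mul_add_eq_of_natDegree_le (hv _) (hv _)]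

-- The leading coefficients of the entries of highest degree cannot cancel.
theorem natDegree_le_of_natDegree_weightedSumSquares_le
    (hc : (weightedSumSquares K c).Anisotropic) {n : ℕ} {v : ι → K[X]}
    (h : (weightedSumSquares K[X] c v).natDegree ≤ n + n) (i : ι) : (v i).natDegree ≤ n := by
  obtain ⟨j, -, hj⟩ := Finset.exists_max_image Finset.univ (fun i => (v i).natDegree)
    ⟨i, Finset.mem_univ i⟩
  refine (hj i (Finset.mem_univ i)).trans (not_lt.1 fun hlt => ?_)
  have hzero : (fun i => (v i).coeff (v j).natDegree) = 0 := by
    apply hc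
    rw [← coeff_weightedSumSquares fun i => hj i (Finset.mem_univ i)]
    exact coeff_eq_zero_of_natDegree_lt (by omega)
  have hvj : v j = 0 := leadingCoeff_eq_zero.1 (congrFun hzero j)
  rw [hvj, natDegree_zero] at hlt
  exact Nat.not_lt_zero _ hlt

theorem anisotropic_weightedSumSquares_polynomial (hc : (weightedSumSquares K c).Anisotropic) :
    (weightedSumSquares K[X] c).Anisotropic := by
  intro v hv
  have hdeg (i : ι) : (v i).natDegree ≤ 0 :=
    natDegree_le_of_natDegree_weightedSumSquares_le hc (by simp only [hv, natDegree_zero]; rfl) i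
  have hzero : (fun i => (v i).coeff 0) = 0 :=
    hc _ (by rw [← coeff_weightedSumSquares hdeg, hv, coeff_zero])
  ext1 i
  rw [eq_C_of_natDegree_le_zero (hdeg i), congrFun hzero i, Pi.zero_apply, C_0, Pi.zero_apply]

/- The line through the rational point `v / h` of the quadric `q = f` and the polynomial point
`w = v div h` meets the quadric in a second point, which has a denominator of smaller degree. -/
theorem exists_smaller_denominator (hc : (weightedSumSquares K c).Anisotropic) {f h : K[X]}
    {v : ι → K[X]} (hh : 0 < h.natDegree) (hv : weightedSumSquares K[X] c v = f * h ^ 2) :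
    ∃ (h' : K[X]) (v' : ι → K[X]), h' ≠ 0 ∧ h'.natDegree < h.natDegree ∧
      weightedSumSquares K[X] c v' = f * h' ^ 2 := by
  set q := weightedSumSquares K[X] c
  set w : ι → K[X] := fun i => v i / h
  set r : ι → K[X] := fun i => v i % h
  have hh0 : h ≠ 0 := ne_zero_of_natDegree_gt hh
  have hvr : v = h • w + r := funext fun i => (EuclideanDomain.div_add_mod (v i) h).symm
  by_cases hr : r = 0
  · refine ⟨1, w, one_ne_zero, by rwa [natDegree_one], mul_left_cancel₀ (pow_ne_zero 2 hh0) ?_⟩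
    rw [hvr, hr, add_zero, QuadraticMap.map_smul, smul_eq_mul] at hv
    linear_combination hv
  · set a := q w - f with ha
    set b := 2 * f * h - polar q v w with hb
    have hqr : q r = h * (a * h + b) := by
      have hr' : r = (1 : K[X]) • v + (-h) • w := by
        rw [one_smul, neg_smul, hvr, add_neg_cancel_comm]
      rw [hr', map_smul_add_smul, hv, ha, hb]
      ring
    have hqr0 : q r ≠ 0 := mt (anisotropic_weightedSumSquares_polynomial hc r) hr
    have hne : a * h + b ≠ 0 := right_ne_zero_of_mul (hqr ▸ hqr0)
    refine ⟨a * h + b, a • v + b • w, hne, ?_, ?_⟩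
    · have hdeg : (q r).natDegree ≤ (h.natDegree - 1) + (h.natDegree - 1) :=
        natDegree_weightedSumSquares_le fun i =>
          Nat.le_sub_one_of_lt (natDegree_mod_lt (v i) hh.ne')
      rw [hqr, natDegree_mul hh0 hne] at hdeg
      omega
    · rw [map_smul_add_smul, hv, ha, hb]
      ring

theorem exists_weightedSumSquares_eq_of_mul_sq (hc : (weightedSumSquares K c).Anisotropic)
    {f h : K[X]} {v : ι → K[X]} (hh : h ≠ 0) (hv : weightedSumSquares K[X] c v = f * h ^ 2) :
    ∃ w, weightedSumSquares K[X] c w = f := by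
  induction hn : h.natDegree using Nat.strong_induction_on generalizing h v with
  | _ n ih =>
    obtain hzero | hpos := h.natDegree.eq_zero_or_pos
    · obtain ⟨k, rfl⟩ : ∃ k, h = C k := ⟨_, eq_C_of_natDegree_eq_zero hzero⟩
      refine ⟨C k⁻¹ • v, ?_⟩
      have hk : C k * C k⁻¹ = 1 := by rw [← C_mul, mul_inv_cancel₀ (C_ne_zero.1 hh), C_1]
      rw [QuadraticMap.map_smul, hv, smul_eq_mul]
      linear_combination f * (C k * C k⁻¹ + 1) * hk
    · obtain ⟨h', v', hh', hlt, hv'⟩ := exists_smaller_denominator hc hpos hv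
      exact ih _ (hn ▸ hlt) hh' hv' rfl

theorem exists_common_denominator {ι : Type*} [Finite ι] (v : ι → RatFunc K) :
    ∃ (h : K[X]) (w : ι → K[X]), h ≠ 0 ∧
      algebraMap K[X] (RatFunc K) h • v = algebraMap K[X] (RatFunc K) ∘ w := by
  obtain ⟨h, hh⟩ := IsLocalization.exist_integer_multiples_of_finite (nonZeroDivisors K[X]) v
  choose w hw using hh
  exact ⟨h, w, nonZeroDivisors.ne_zero h.2, funext fun i =>
    ((hw i).trans (Algebra.smul_def _ _)).symm⟩

theorem algebraMap_weightedSumSquares_eq_sq_mul {h : K[X]} {v : ι → RatFunc K} {w : ι → K[X]}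
    (hw : algebraMap K[X] (RatFunc K) h • v = algebraMap K[X] (RatFunc K) ∘ w) :
    algebraMap K[X] (RatFunc K) (weightedSumSquares K[X] c w) =
      algebraMap K[X] (RatFunc K) h ^ 2 * weightedSumSquares (RatFunc K) c v := by
  refine (weightedSumSquares_comp_algHom (IsScalarTower.toAlgHom K K[X] (RatFunc K)) c w).symm.trans
    ?_
  rw [IsScalarTower.coe_toAlgHom', ← hw, QuadraticMap.map_smul, smul_eq_mul, sq]

theorem anisotropic_weightedSumSquares_ratFunc (hc : (weightedSumSquares K c).Anisotropic) :
    (weightedSumSquares (RatFunc K) c).Anisotropic := by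
  intro v hv
  obtain ⟨h, w, hh, hw⟩ := exists_common_denominator v
  have hw0 : w = 0 := by
    apply anisotropic_weightedSumSquares_polynomial hc
    apply RatFunc.algebraMap_injective K
    rw [algebraMap_weightedSumSquares_eq_sq_mul hw, hv, mul_zero, map_zero]
  rw [hw0, Pi.comp_zero, map_zero] at hw
  exact (smul_eq_zero.1 hw).resolve_left (RatFunc.algebraMap_ne_zero hh)

/-- **Cassels–Pfister theorem** -/
theorem exists_polynomial_of_weightedSumSquares_eq_algebraMap
    (hc : (weightedSumSquares K c).Anisotropic) {f : K[X]} {v : ι → RatFunc K}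
    (hv : weightedSumSquares (RatFunc K) c v = algebraMap K[X] (RatFunc K) f) :
    ∃ w, weightedSumSquares K[X] c w = f := by
  obtain ⟨h, w, hh, hw⟩ := exists_common_denominator v
  refine exists_weightedSumSquares_eq_of_mul_sq hc hh (v := w) (RatFunc.algebraMap_injective K ?_)
  rw [algebraMap_weightedSumSquares_eq_sq_mul hw, hv, map_mul, map_pow, mul_comm]

theorem polar_weightedSumSquares {A : Type*} [CommRing A] [Algebra K A] (v w : ι → A) :
    polar (weightedSumSquares A c) v w = ∑ i, c i • (2 * (v i * w i)) := by
  simp only [polar, weightedSumSquares_apply, ← Finset.sum_sub_distrib, ← smul_sub, Pi.add_apply]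
  exact Finset.sum_congr rfl fun i _ => by ring_nf

theorem weightedSumSquares_algebraMap_comp {A : Type*} [CommRing A] [Algebra K A] :
    weightedSumSquares A (algebraMap K A ∘ c) = weightedSumSquares A c := by
  ext v
  simp only [weightedSumSquares_apply, Function.comp_apply, algebraMap_smul]

theorem weightedSumSquares_comp_algebraMap (A : Type*) [CommRing A] [Algebra K A] (v : ι → K) :
    weightedSumSquares A c (algebraMap K A ∘ v) = algebraMap K A (weightedSumSquares K c v) :=
  weightedSumSquares_comp_algHom (Algebra.ofId K A) c v

theorem polar_weightedSumSquares_comp_algebraMap (A : Type*) [CommRing A] [Algebra K A]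
    (v w : ι → K) :
    polar (weightedSumSquares A c) (algebraMap K A ∘ v) (algebraMap K A ∘ w) =
      algebraMap K A (polar (weightedSumSquares K c) v w) := by
  rw [polar, polar, map_sub, map_sub, ← weightedSumSquares_comp_algebraMap,
    ← weightedSumSquares_comp_algebraMap, ← weightedSumSquares_comp_algebraMap]
  congr 3
  exact funext fun i => (map_add _ _ _).symm

theorem weightedSumSquares_add_smul {A : Type*} [CommRing A] [Algebra K A] (t : A) (P Q : ι → K) :
    weightedSumSquares A c (algebraMap K A ∘ P + t • (algebraMap K A ∘ Q)) =
      algebraMap K A (weightedSumSquares K c P) +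
        t * algebraMap K A (polar (weightedSumSquares K c) P Q) +
        t ^ 2 * algebraMap K A (weightedSumSquares K c Q) := by
  rw [← one_smul A (algebraMap K A ∘ P), map_smul_add_smul, weightedSumSquares_comp_algebraMap,
    weightedSumSquares_comp_algebraMap, polar_weightedSumSquares_comp_algebraMap, one_pow, one_mul,
    one_mul]

theorem exists_orthogonal (hc : (weightedSumSquares K c).Anisotropic) {a b : K}
    {w : ι → RatFunc K}
    (hw : weightedSumSquares (RatFunc K) c w =
      algebraMap K (RatFunc K) b + algebraMap K (RatFunc K) a * RatFunc.X ^ 2) :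
    ∃ P Q : ι → K, weightedSumSquares K c P = b ∧ weightedSumSquares K c Q = a ∧
      polar (weightedSumSquares K c) P Q = 0 := by
  obtain ⟨u, hu⟩ := exists_polynomial_of_weightedSumSquares_eq_algebraMap hc
    (f := C b + C a * X ^ 2) (by simpa using hw)
  have hdeg (i : ι) : (u i).natDegree ≤ 1 :=
    natDegree_le_of_natDegree_weightedSumSquares_le hc (by rw [hu]; compute_degree) i
  set P : ι → K := fun i => (u i).coeff 0
  set Q : ι → K := fun i => (u i).coeff 1
  have hlin : u = algebraMap K K[X] ∘ P + (X : K[X]) • (algebraMap K K[X] ∘ Q) := by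
    ext1 i
    rw [eq_X_add_C_of_natDegree_le_one (hdeg i), add_comm, mul_comm]
    rfl
  rw [hlin, weightedSumSquares_add_smul, algebraMap_eq] at hu
  have hcoeff (n : ℕ) := congrArg (fun p => p.coeff n) hu
  simp only [coeff_add, coeff_mul_C, coeff_C_mul, coeff_C, coeff_X, coeff_X_pow] at hcoeff
  exact ⟨P, Q, by simpa using hcoeff 0, by simpa using hcoeff 2, by simpa using hcoeff 1⟩

theorem exists_weightedSumSquares_eq_of_ratFunc (hc : (weightedSumSquares K c).Anisotropic) {a : K}
    {w : ι → RatFunc K}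
    (hw : weightedSumSquares (RatFunc K) c w = algebraMap K (RatFunc K) a) :
    ∃ P : ι → K, weightedSumSquares K c P = a := by
  obtain ⟨P, -, hP, -, -⟩ := exists_orthogonal (a := 0) (b := a) hc
    (by rw [hw, map_zero, zero_mul, add_zero])
  exact ⟨P, hP⟩

end CasselsPfister

section Nonsplit

/-- `(a, b / K)` is a division algebra. -/
def IsNonsplit {K : Type*} [Field K] (a b : K) : Prop :=
  ∀ x : ℍ[K,a,b], x ≠ 0 → IsUnit x

/-- The norm form `⟨1, -a, -b, ab⟩` of `(a, b / K)`. -/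
def normCoeffs {K : Type*} [Field K] (a b : K) : Fin 4 → K := ![1, -a, -b, a * b]

/-- The form `⟨a, b, -ab⟩`, which is the squaring map on the trace-zero part of `(a, b / K)`. -/
def pureCoeffs {K : Type*} [Field K] (a b : K) : Fin 3 → K := ![a, b, -(a * b)]

/-- The trace-zero quaternion with the given coordinates in the basis `i, j, ij`. -/
def pureQuaternion {K : Type*} [Field K] (a b : K) (w : Fin 3 → K) : ℍ[K,a,b] :=
  ⟨0, w 0, w 1, w 2⟩

variable {K : Type*} [Field K] {a b : K}

theorem mul_star_eq_norm (x : ℍ[K,a,b]) :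
    x * star x = algebraMap K _ (weightedSumSquares K (normCoeffs a b)
      (QuaternionAlgebra.equivTuple a 0 b x)) := by
  ext <;> simp [normCoeffs, Fin.sum_univ_four] <;> ring

theorem star_mul_eq_norm (x : ℍ[K,a,b]) :
    star x * x = algebraMap K _ (weightedSumSquares K (normCoeffs a b)
      (QuaternionAlgebra.equivTuple a 0 b x)) := by
  rw [star_comm_self', mul_star_eq_norm]

theorem isNonsplit_iff_anisotropic :
    IsNonsplit a b ↔ (weightedSumSquares K (normCoeffs a b)).Anisotropic := by
  constructor
  · intro h v hv
    obtain ⟨x, rfl⟩ := (QuaternionAlgebra.equivTuple a 0 b).surjective v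
    by_contra hx
    have hx0 : x ≠ 0 := by
      rintro rfl
      exact hx (map_zero (QuaternionAlgebra.linearEquivTuple a 0 b))
    have hmul : x * star x = 0 := by rw [mul_star_eq_norm, hv, map_zero]
    exact hx0 (star_eq_zero.1 ((h x hx0).mul_right_eq_zero.1 hmul))
  · intro h x hx
    set n := weightedSumSquares K (normCoeffs a b) (QuaternionAlgebra.equivTuple a 0 b x) with hn
    have hn0 : n ≠ 0 := fun h0 =>
      hx ((QuaternionAlgebra.linearEquivTuple a 0 b).map_eq_zero_iff.1 (h _ h0))
    refine ⟨⟨x, n⁻¹ • star x, ?_, ?_⟩, rfl⟩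
    · rw [mul_smul_comm, mul_star_eq_norm, ← hn, Algebra.smul_def, ← map_mul, inv_mul_cancel₀ hn0,
        map_one]
    · rw [smul_mul_assoc, star_mul_eq_norm, ← hn, Algebra.smul_def, ← map_mul,
        inv_mul_cancel₀ hn0, map_one]

theorem weightedSumSquares_normCoeffs_algebraMap (L : Type*) [Field L] [Algebra K L] :
    weightedSumSquares L (normCoeffs (algebraMap K L a) (algebraMap K L b)) =
      weightedSumSquares L (normCoeffs a b) := by
  have hcoeffs : normCoeffs (algebraMap K L a) (algebraMap K L b) =
      algebraMap K L ∘ normCoeffs a b := by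
    ext i
    fin_cases i <;> simp [normCoeffs]
  rw [hcoeffs, weightedSumSquares_algebraMap_comp]

theorem weightedSumSquares_pureCoeffs_algebraMap (L : Type*) [Field L] [Algebra K L] :
    weightedSumSquares L (pureCoeffs (algebraMap K L a) (algebraMap K L b)) =
      weightedSumSquares L (pureCoeffs a b) := by
  have hcoeffs : pureCoeffs (algebraMap K L a) (algebraMap K L b) =
      algebraMap K L ∘ pureCoeffs a b := by
    ext i
    fin_cases i <;> simp [pureCoeffs]
  rw [hcoeffs, weightedSumSquares_algebraMap_comp]

theorem isNonsplit_algebraMap_iff {L : Type*} [Field L] [Algebra K L] :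
    IsNonsplit (algebraMap K L a) (algebraMap K L b) ↔
      (weightedSumSquares L (normCoeffs a b)).Anisotropic := by
  rw [isNonsplit_iff_anisotropic, weightedSumSquares_normCoeffs_algebraMap]

theorem IsNonsplit.ratFunc (h : IsNonsplit a b) :
    IsNonsplit (algebraMap K (RatFunc K) a) (algebraMap K (RatFunc K) b) :=
  isNonsplit_algebraMap_iff.2
    (anisotropic_weightedSumSquares_ratFunc (isNonsplit_iff_anisotropic.1 h))

theorem IsNonsplit.ne_sq_sub_mul_sq (h : IsNonsplit a b) (u v : K) : b ≠ u ^ 2 - a * v ^ 2 := by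
  intro hb
  have hzero : ![u, v, 1, 0] = 0 := isNonsplit_iff_anisotropic.1 h _ (by
    simp only [weightedSumSquares_apply, normCoeffs, Fin.sum_univ_four, Matrix.cons_val,
      smul_eq_mul]
    linear_combination -hb)
  exact one_ne_zero (congrFun hzero 2)

theorem eq_zero_of_sq_sub_mul_sq_eq_zero (ha : ∀ r : K, r ^ 2 ≠ a) {p q : K}
    (h : p ^ 2 - a * q ^ 2 = 0) : p = 0 ∧ q = 0 := by
  obtain rfl | hq := eq_or_ne q 0
  · exact ⟨by simpa using h, rfl⟩
  · exact (ha (p / q) (by field_simp; linear_combination h)).elim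

theorem isNonsplit_of_ne_sq_sub_mul_sq (ha : ∀ r : K, r ^ 2 ≠ a)
    (hb : ∀ u v : K, b ≠ u ^ 2 - a * v ^ 2) : IsNonsplit a b := by
  refine isNonsplit_iff_anisotropic.2 fun x hx => ?_
  simp only [weightedSumSquares_apply, normCoeffs, Fin.sum_univ_four, Matrix.cons_val,
    smul_eq_mul] at hx
  have hmul : x 0 ^ 2 - a * x 1 ^ 2 = b * (x 2 ^ 2 - a * x 3 ^ 2) := by linear_combination hx
  obtain hN | hN := eq_or_ne (x 2 ^ 2 - a * x 3 ^ 2) 0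
  · obtain ⟨h0, h1⟩ := eq_zero_of_sq_sub_mul_sq_eq_zero ha (p := x 0) (q := x 1)
      (by rw [hmul, hN, mul_zero])
    obtain ⟨h2, h3⟩ := eq_zero_of_sq_sub_mul_sq_eq_zero ha hN
    ext i
    fin_cases i <;> assumption
  · refine (hb ((x 0 * x 2 - a * (x 1 * x 3)) / (x 2 ^ 2 - a * x 3 ^ 2))
      ((x 1 * x 2 - x 0 * x 3) / (x 2 ^ 2 - a * x 3 ^ 2)) ?_).elim
    field_simp
    linear_combination -(x 2 ^ 2 - a * x 3 ^ 2) * hmul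

theorem IsNonsplit.eq_zero_of_pure_eq_sq (h : IsNonsplit a b) {v : Fin 3 → K} {r : K}
    (hr : weightedSumSquares K (pureCoeffs a b) v = r ^ 2) : r = 0 ∧ v = 0 := by
  have hzero : ![r, v 0, v 1, v 2] = 0 := isNonsplit_iff_anisotropic.1 h _ (by
    simp only [weightedSumSquares_apply, pureCoeffs, normCoeffs, Fin.sum_univ_three,
      Fin.sum_univ_four, Matrix.cons_val, smul_eq_mul] at hr ⊢
    linear_combination -hr)
  refine ⟨congrFun hzero 0, ?_⟩
  ext i
  fin_cases i
  exacts [congrFun hzero 1, congrFun hzero 2, congrFun hzero 3]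

theorem IsNonsplit.anisotropic_pure (h : IsNonsplit a b) :
    (weightedSumSquares K (pureCoeffs a b)).Anisotropic := fun _ hv =>
  (h.eq_zero_of_pure_eq_sq (r := 0) (by rw [hv, zero_pow two_ne_zero])).2

theorem pureQuaternion_mul_self (w : Fin 3 → K) :
    pureQuaternion a b w * pureQuaternion a b w =
      algebraMap K _ (weightedSumSquares K (pureCoeffs a b) w) := by
  ext <;> simp [pureQuaternion, pureCoeffs, Fin.sum_univ_three] <;> ring

theorem pureQuaternion_mul_add_mul (v w : Fin 3 → K) :
    pureQuaternion a b v * pureQuaternion a b w + pureQuaternion a b w * pureQuaternion a b v =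
      algebraMap K _ (polar (weightedSumSquares K (pureCoeffs a b)) v w) := by
  have hadd : pureQuaternion a b (v + w) = pureQuaternion a b v + pureQuaternion a b w :=
    QuaternionAlgebra.ext (add_zero 0).symm rfl rfl rfl
  rw [polar, map_sub, map_sub, ← pureQuaternion_mul_self, ← pureQuaternion_mul_self,
    ← pureQuaternion_mul_self, hadd]
  noncomm_ring

theorem exists_eq_pureQuaternion {x : ℍ[K,a,b]} (hx : x.re = 0) :
    ∃ w, x = pureQuaternion a b w :=
  ⟨![x.imI, x.imJ, x.imK], QuaternionAlgebra.ext hx rfl rfl rfl⟩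

theorem exists_mul_self_eq (x : ℍ[K,a,b]) :
    ∃ t n : K, x * x = t • x + algebraMap K _ n := by
  refine ⟨2 * x.re, -weightedSumSquares K (normCoeffs a b)
    (QuaternionAlgebra.equivTuple a 0 b x), ?_⟩
  ext <;> simp [normCoeffs, Fin.sum_univ_four] <;> ring

-- Commuting quaternions have parallel imaginary parts.
theorem exists_eq_add_smul_of_commute [NeZero (2 : K)] (ha : a ≠ 0) (hb : b ≠ 0) {x y : ℍ[K,a,b]}
    (hx : x ∉ Set.range (algebraMap K ℍ[K,a,b])) (hxy : Commute x y) :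
    ∃ r s : K, y = algebraMap K _ r + s • x := by
  have h2 : (2 : K) ≠ 0 := two_ne_zero
  have hcomm := QuaternionAlgebra.ext_iff.1 hxy.eq
  simp only [QuaternionAlgebra.imI_mul, QuaternionAlgebra.imJ_mul, QuaternionAlgebra.imK_mul]
    at hcomm
  obtain ⟨-, hI, hJ, hK⟩ := hcomm
  have hJK : x.imJ * y.imK - x.imK * y.imJ = 0 :=
    (mul_eq_zero_iff_left (mul_ne_zero h2 hb)).1 (by linear_combination -hI)
  have hKI : x.imK * y.imI - x.imI * y.imK = 0 :=
    (mul_eq_zero_iff_left (mul_ne_zero h2 ha)).1 (by linear_combination -hJ)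
  have hIJ : x.imI * y.imJ - x.imJ * y.imI = 0 :=
    (mul_eq_zero_iff_left h2).1 (by linear_combination hK)
  set v := ![x.imI, x.imJ, x.imK]
  set w := ![y.imI, y.imJ, y.imK]
  have hv0 : v ≠ 0 := fun h0 => hx
    ⟨x.re, QuaternionAlgebra.ext rfl (congrFun h0 0).symm (congrFun h0 1).symm (congrFun h0 2).symm⟩
  have hdep : ¬LinearIndependent K ![v, w] := by
    rw [← crossProduct_ne_zero_iff_linearIndependent, not_not, cross_apply]
    simp only [v, w, Matrix.cons_val, hJK, hKI, hIJ, Matrix.cons_eq_zero_iff,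
      Matrix.zero_empty, and_self]
  rw [LinearIndependent.pair_iff' hv0, not_forall_not] at hdep
  obtain ⟨s, hs⟩ := hdep
  refine ⟨y.re - s * x.re, s, ?_⟩
  ext
  · simp
  · simpa [v, w] using (congrFun hs 0).symm
  · simpa [v, w] using (congrFun hs 1).symm
  · simpa [v, w] using (congrFun hs 2).symm

end Nonsplit

section QuaternionAlgebra

variable {K D : Type*} [Field K] [DivisionRing D] [Algebra K D]

theorem IsQuaternionAlgebra.exists_mul_self_eq (hD : IsQuaternionAlgebra K D) (x : D) :
    ∃ t n : K, x * x = t • x + algebraMap K D n := by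
  obtain ⟨a, b, -, -, ⟨e⟩⟩ := hD
  obtain ⟨t, n, h⟩ := _root_.exists_mul_self_eq (e x)
  exact ⟨t, n, e.injective (by simpa using h)⟩

theorem IsQuaternionAlgebra.exists_eq_add_smul_of_commute [NeZero (2 : K)]
    (hD : IsQuaternionAlgebra K D) {x y : D} (hx : x ∉ Set.range (algebraMap K D))
    (hxy : Commute x y) : ∃ r s : K, y = algebraMap K D r + s • x := by
  obtain ⟨a, b, ha, hb, ⟨e⟩⟩ := hD
  obtain ⟨r, s, h⟩ := _root_.exists_eq_add_smul_of_commute ha hb (x := e x) (y := e y)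
    (fun ⟨r, hr⟩ => hx ⟨r, e.injective (by rw [e.commutes, hr])⟩) (hxy.map e)
  exact ⟨r, s, e.injective (by simpa using h)⟩

/- Skolem–Noether for two square roots `i`, `i'` of the same scalar: `g = i + i'` conjugates one
into the other unless `i' = -i`, and then any `j` anticommuting with `i` does. -/
theorem exists_mul_eq_mul_of_mul_self_eq {i i' j : D} (hi : i * i = i' * i') (hj : j ≠ 0)
    (hij : i * j = -(j * i)) : ∃ g ≠ 0, i * g = g * i' := by
  by_cases h : i + i' = 0
  · rw [eq_neg_of_add_eq_zero_right h]
    exact ⟨j, hj, by rw [hij, mul_neg]⟩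
  · exact ⟨i + i', h, by rw [mul_add, add_mul, hi, add_comm]⟩

theorem notMem_range_algebraMap_of_anticommute [NeZero (2 : K)] {i j : D} (hi : i ≠ 0) (hj : j ≠ 0)
    (hij : i * j = -(j * i)) : i ∉ Set.range (algebraMap K D) := by
  rintro ⟨r, rfl⟩
  rw [Algebra.commutes, eq_neg_iff_add_eq_zero, ← two_mul] at hij
  have h2 : (2 : D) ≠ 0 := by
    rw [← map_ofNat (algebraMap K D) 2]
    exact (_root_.map_ne_zero _).2 two_ne_zero
  exact mul_ne_zero h2 (mul_ne_zero hj hi) hij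

/- After conjugating `i'` into `i`, the product of `j` and the conjugate of `j'` commutes with `i`,
so it is `r + s i`, whose norm is `b b'`. -/
theorem IsQuaternionAlgebra.exists_norm_eq_mul [NeZero (2 : K)] (hD : IsQuaternionAlgebra K D)
    {a b b' : K} {i j i' j' : D} (hi : i * i = algebraMap K D a) (hi' : i' * i' = algebraMap K D a)
    (hj : j * j = algebraMap K D b) (hj' : j' * j' = algebraMap K D b') (ha : a ≠ 0) (hb : b ≠ 0)
    (hij : i * j = -(j * i)) (hij' : i' * j' = -(j' * i')) :
    ∃ r s : K, r ^ 2 - a * s ^ 2 = b * b' := by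
  have hi0 : i ≠ 0 := left_ne_zero_of_mul (hi ▸ (_root_.map_ne_zero _).2 ha)
  have hj0 : j ≠ 0 := left_ne_zero_of_mul (hj ▸ (_root_.map_ne_zero _).2 hb)
  obtain ⟨g, hg, hgi⟩ := exists_mul_eq_mul_of_mul_self_eq (hi.trans hi'.symm) hj0 hij
  obtain ⟨x, hx⟩ : ∃ x, x * g = g * j' := ⟨g * j' * g⁻¹, inv_mul_cancel_right₀ hg _⟩
  have hxx : x * x = algebraMap K D b' := mul_right_cancel₀ hg <| by
    rw [mul_assoc, hx, ← mul_assoc, hx, mul_assoc, hj', Algebra.commutes]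
  have hix : i * x = -(x * i) := mul_right_cancel₀ hg <| by
    rw [mul_assoc, hx, ← mul_assoc, hgi, mul_assoc, hij', neg_mul, mul_assoc x, hgi, ← mul_assoc,
      hx, mul_neg, mul_assoc]
  have hcomm : Commute i (j * x) := by
    rw [Commute, SemiconjBy, ← mul_assoc, hij, neg_mul, mul_assoc, hix, mul_neg, neg_neg, mul_assoc]
  obtain ⟨r, s, hrs⟩ := hD.exists_eq_add_smul_of_commute
    (notMem_range_algebraMap_of_anticommute (K := K) hi0 hj0 hij) hcomm
  refine ⟨r, s, (algebraMap K D).injective ?_⟩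
  have hconj : j * (j * x) = (algebraMap K D r - s • i) * j := by
    rw [hrs, mul_add, sub_mul, mul_smul_comm, smul_mul_assoc, hij, smul_neg, sub_neg_eq_add,
      Algebra.commutes]
  calc algebraMap K D (r ^ 2 - a * s ^ 2)
      = (algebraMap K D r - s • i) * (algebraMap K D r + s • i) := by
        rw [← Commute.mul_self_sub_mul_self_eq' (Algebra.commutes r (s • i)), smul_mul_smul_comm,
          hi, Algebra.smul_def, ← map_mul, ← map_mul, ← map_sub]
        congr 1
        ring
    _ = j * (j * x) * x := by rw [hconj, mul_assoc, hrs]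
    _ = algebraMap K D (b * b') := by rw [← mul_assoc, hj, mul_assoc, hxx, map_mul]

end QuaternionAlgebra

section QuadraticExtension

variable {F : Type*} [Field F] {A B f : F}

theorem weightedSumSquares_quadraticAlgebra_eq_zero {ι : Type*} [Fintype ι] {c : ι → F}
    {v : ι → QuadraticAlgebra F f 0} (hv : weightedSumSquares _ c v = 0) :
    (weightedSumSquares F c fun i => (v i).re) +
        f * (weightedSumSquares F c fun i => (v i).im) = 0 ∧
      polar (weightedSumSquares F c) (fun i => (v i).re) (fun i => (v i).im) = 0 := by
  set P : ι → F := fun i => (v i).re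
  set Q : ι → F := fun i => (v i).im
  have hlin : v = algebraMap F (QuadraticAlgebra F f 0) ∘ P +
      (QuadraticAlgebra.omega : QuadraticAlgebra F f 0) •
        (algebraMap F (QuadraticAlgebra F f 0) ∘ Q) := by
    ext i <;> simp [P, Q]
  rw [hlin, weightedSumSquares_add_smul, pow_two] at hv
  have hre := congrArg QuadraticAlgebra.re hv
  have him := congrArg QuadraticAlgebra.im hv
  simp only [QuadraticAlgebra.re_add, QuadraticAlgebra.re_mul, QuadraticAlgebra.im_add,
    QuadraticAlgebra.im_mul, QuadraticAlgebra.algebraMap_re, QuadraticAlgebra.algebraMap_im,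
    QuadraticAlgebra.omega_re, QuadraticAlgebra.omega_im, QuadraticAlgebra.re_zero,
    QuadraticAlgebra.im_zero] at hre him
  exact ⟨by linear_combination hre, by linear_combination him⟩

theorem star_pureQuaternion (w : Fin 3 → F) :
    star (pureQuaternion A B w) = -pureQuaternion A B w := by
  ext <;> simp [pureQuaternion]

/- If `x + √f y` is a zero of the norm form then `x * star y` has trace zero, and its square is
`f` times the square of the norm of `y`. -/
theorem IsNonsplit.exists_pure_eq_of_not_anisotropic [NeZero (2 : F)] (h : IsNonsplit A B)
    (hf : ¬(weightedSumSquares (QuadraticAlgebra F f 0) (normCoeffs A B)).Anisotropic) :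
    ∃ w, weightedSumSquares F (pureCoeffs A B) w = f := by
  have haniso := isNonsplit_iff_anisotropic.1 h
  simp only [QuadraticMap.Anisotropic, not_forall] at hf
  obtain ⟨v, hv, hv0⟩ := hf
  obtain ⟨hre, him⟩ := weightedSumSquares_quadraticAlgebra_eq_zero hv
  obtain ⟨x, hx⟩ := (QuaternionAlgebra.equivTuple A 0 B).surjective fun i => (v i).re
  obtain ⟨y, hy⟩ := (QuaternionAlgebra.equivTuple A 0 B).surjective fun i => (v i).im
  rw [← hx, ← hy] at hre him
  set n := weightedSumSquares F (normCoeffs A B) (QuaternionAlgebra.equivTuple A 0 B y) with hn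
  have hn0 : n ≠ 0 := by
    intro hn0
    rw [hn0, mul_zero, add_zero] at hre
    have him0 := hy.symm.trans (haniso _ hn0)
    have hre0 := hx.symm.trans (haniso _ hre)
    exact hv0 (funext fun i => QuadraticAlgebra.ext (congrFun hre0 i) (congrFun him0 i))
  have htrace : (x * star y).re = 0 := by
    refine (mul_eq_zero_iff_left (two_ne_zero (α := F))).1 (Eq.trans ?_ him)
    rw [polar_weightedSumSquares]
    simp only [normCoeffs, Fin.sum_univ_four, Matrix.cons_val, smul_eq_mul,
      QuaternionAlgebra.equivTuple_apply, QuaternionAlgebra.re_mul, QuaternionAlgebra.re_star,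
      QuaternionAlgebra.imI_star, QuaternionAlgebra.imJ_star, QuaternionAlgebra.imK_star]
    ring
  obtain ⟨w, hw⟩ := exists_eq_pureQuaternion htrace
  have hsq : weightedSumSquares F (pureCoeffs A B) w = f * n ^ 2 := by
    apply (algebraMap F ℍ[F,A,B]).injective
    calc algebraMap F ℍ[F,A,B] (weightedSumSquares F (pureCoeffs A B) w)
        = -((x * star y) * star (x * star y)) := by
          rw [hw, star_pureQuaternion, mul_neg, neg_neg, pureQuaternion_mul_self]
      _ = -(x * (star y * y) * star x) := by simp only [star_mul, star_star, mul_assoc]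
      _ = -(n • (x * star x)) := by
          rw [star_mul_eq_norm, ← hn, ← Algebra.commutes, mul_assoc, Algebra.smul_def]
      _ = algebraMap F ℍ[F,A,B] (f * n ^ 2) := by
          rw [mul_star_eq_norm, Algebra.smul_def, ← map_mul, ← map_neg]
          congr 1
          linear_combination -n * hre
  exact ⟨n⁻¹ • w, by rw [QuadraticMap.map_smul, hsq, smul_eq_mul]; field_simp⟩

end QuadraticExtension

section Quadric

variable {K : Type*} [Field K] {A B a b d : K}

theorem ratFunc_ne_sq [NeZero (2 : K)] (ha : a ≠ 0) (hb : b ≠ 0) (r : RatFunc K) :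
    r ^ 2 ≠ algebraMap K (RatFunc K) b + algebraMap K (RatFunc K) a * RatFunc.X ^ 2 := by
  intro hr
  have haniso : (weightedSumSquares K fun _ : Unit => (1 : K)).Anisotropic := fun v hv => by
    ext
    simpa using hv
  obtain ⟨P, Q, hP, hQ, hPQ⟩ := exists_orthogonal haniso (w := fun _ => r) (by
    rw [← hr, weightedSumSquares_apply, Fintype.sum_unique, one_smul, pow_two])
  rw [polar_weightedSumSquares] at hPQ
  simp only [weightedSumSquares_apply, Fintype.sum_unique, one_smul, mul_eq_zero, two_ne_zero,
    false_or] at hP hQ hPQ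
  obtain h0 | h0 := hPQ
  · exact hb (by rw [← hP, h0, zero_mul])
  · exact ha (by rw [← hQ, h0, zero_mul])

instance [NeZero (2 : K)] : NeZero (2 : RatFunc K) :=
  ⟨by rw [← map_ofNat (algebraMap K (RatFunc K)) 2]; exact (_root_.map_ne_zero _).2 two_ne_zero⟩

theorem IsNonsplit.ne_zero (h : IsNonsplit A B) : A ≠ 0 ∧ B ≠ 0 := by
  constructor <;> rintro rfl
  · exact Pi.single_ne_zero_iff.2 one_ne_zero (h.anisotropic_pure (Pi.single 0 1) (by
      simp [pureCoeffs, Fin.sum_univ_three]))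
  · exact Pi.single_ne_zero_iff.2 one_ne_zero (h.anisotropic_pure (Pi.single 1 1) (by
      simp [pureCoeffs, Fin.sum_univ_three]))

theorem exists_ne_zero_polar_eq_zero (Q : QuadraticForm K (Fin 3 → K)) (v : Fin 3 → K) :
    ∃ w ≠ 0, polar Q v w = 0 := by
  have hker : LinearMap.ker (Q.polarBilin v) ≠ ⊥ :=
    LinearMap.ker_ne_bot_of_finrank_lt (by simp)
  obtain ⟨w, hw, hw0⟩ := (Submodule.ne_bot_iff _).1 hker
  exact ⟨w, hw0, hw⟩

theorem IsNonsplit.exists_norm_eq_mul_of_polar_eq_zero [NeZero (2 : K)] (h : IsNonsplit A B)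
    {α β γ : K} {v v' w w' : Fin 3 → K} (hα : α ≠ 0) (hγ : γ ≠ 0)
    (hv : weightedSumSquares K (pureCoeffs A B) v = α)
    (hv' : weightedSumSquares K (pureCoeffs A B) v' = α)
    (hw : weightedSumSquares K (pureCoeffs A B) w = γ)
    (hw' : weightedSumSquares K (pureCoeffs A B) w' = β)
    (hvw : polar (weightedSumSquares K (pureCoeffs A B)) v w = 0)
    (hvw' : polar (weightedSumSquares K (pureCoeffs A B)) v' w' = 0) :
    ∃ r s : K, r ^ 2 - α * s ^ 2 = γ * β := by
  let _ : DivisionRing ℍ[K,A,B] :=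
    DivisionRing.ofIsUnitOrEqZero fun x => (eq_or_ne x 0).symm.imp (h x) id
  have hD : IsQuaternionAlgebra K ℍ[K,A,B] := ⟨A, B, h.ne_zero.1, h.ne_zero.2, ⟨AlgEquiv.refl⟩⟩
  have hanti {v w : Fin 3 → K} (hvw : polar (weightedSumSquares K (pureCoeffs A B)) v w = 0) :
      pureQuaternion A B v * pureQuaternion A B w =
        -(pureQuaternion A B w * pureQuaternion A B v) := by
    rw [eq_neg_iff_add_eq_zero, pureQuaternion_mul_add_mul, hvw, map_zero]
  exact hD.exists_norm_eq_mul (by rw [pureQuaternion_mul_self, hv])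
    (by rw [pureQuaternion_mul_self, hv']) (by rw [pureQuaternion_mul_self, hw])
    (by rw [pureQuaternion_mul_self, hw']) hα hγ (hanti hvw) (hanti hvw')

theorem IsNonsplit.exists_norm_of_orthogonal [NeZero (2 : K)] (h : IsNonsplit A B) {α : K}
    (hα : α ≠ 0) {β : RatFunc K} {P Q : Fin 3 → RatFunc K}
    (hP : weightedSumSquares (RatFunc K) (pureCoeffs A B) P = β)
    (hQ : weightedSumSquares (RatFunc K) (pureCoeffs A B) Q = algebraMap K (RatFunc K) α)
    (hPQ : polar (weightedSumSquares (RatFunc K) (pureCoeffs A B)) P Q = 0) :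
    ∃ γ ≠ 0, ∃ r s : RatFunc K,
      r ^ 2 - algebraMap K (RatFunc K) α * s ^ 2 = algebraMap K (RatFunc K) γ * β := by
  obtain ⟨v, hv⟩ := exists_weightedSumSquares_eq_of_ratFunc h.anisotropic_pure hQ
  obtain ⟨w, hw0, hvw⟩ := exists_ne_zero_polar_eq_zero (weightedSumSquares K (pureCoeffs A B)) v
  have hw : weightedSumSquares K (pureCoeffs A B) w ≠ 0 := fun hw => hw0 (h.anisotropic_pure w hw)
  rw [← weightedSumSquares_pureCoeffs_algebraMap] at hP hQ hPQ
  rw [QuadraticMap.polar_comm] at hPQ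
  refine ⟨_, hw, h.ratFunc.exists_norm_eq_mul_of_polar_eq_zero
    (v := algebraMap K (RatFunc K) ∘ v) (w := algebraMap K (RatFunc K) ∘ w)
    ((_root_.map_ne_zero _).2 hα) ((_root_.map_ne_zero _).2 hw) ?_ hQ ?_ hP ?_ hPQ⟩
  all_goals rw [weightedSumSquares_pureCoeffs_algebraMap]
  · rw [weightedSumSquares_comp_algebraMap, hv]
  · rw [weightedSumSquares_comp_algebraMap]
  · rw [polar_weightedSumSquares_comp_algebraMap, hvw, map_zero]

/-- `f = b - ab v² + ad y²` over `K(v, y)`: adjoining `√f` gives the function field of the quadric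
`a x² + b y² - ab z² = d`, with generic point `(√f / (ay), v / y, 1 / (ay))`. The inner variable of
the iterated `RatFunc` is `v` and the outer one is `y`. -/
noncomputable def quadricRadicand (a b d : K) : RatFunc (RatFunc K) :=
  algebraMap (RatFunc K) _ (algebraMap K _ b + algebraMap K _ (-(a * b)) * RatFunc.X ^ 2) +
    algebraMap (RatFunc K) _ (algebraMap K _ (a * d)) * RatFunc.X ^ 2

/-- The function field `K(v, y)(√f)` of the quadric `a x² + b y² - ab z² = d`. -/
abbrev QuadricFunctionField (a b d : K) : Type _ :=
  QuadraticAlgebra (RatFunc (RatFunc K)) (quadricRadicand a b d) 0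

theorem sq_ne_quadricRadicand [NeZero (2 : K)] (ha : a ≠ 0) (hb : b ≠ 0) (hd : d ≠ 0)
    (r : RatFunc (RatFunc K)) : r ^ 2 ≠ quadricRadicand a b d := by
  refine ratFunc_ne_sq ((_root_.map_ne_zero _).2 (mul_ne_zero ha hd)) (fun h0 => ?_) r
  exact ratFunc_ne_sq (neg_ne_zero.2 (mul_ne_zero ha hb)) hb 0 (by rw [h0, zero_pow two_ne_zero])

theorem exists_mul_eq_of_norm_eq [NeZero (2 : K)] {α p q : K} (hα : ∀ t : K, t ^ 2 ≠ α)
    {r s : RatFunc K} (hrs : r ^ 2 - algebraMap K (RatFunc K) α * s ^ 2 =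
      algebraMap K (RatFunc K) p + algebraMap K (RatFunc K) q * RatFunc.X ^ 2) :
    ∃ t, p * q = -(α * t ^ 2) := by
  have haniso : (weightedSumSquares K ![1, -α]).Anisotropic := by
    intro v hv
    obtain ⟨h0, h1⟩ := eq_zero_of_sq_sub_mul_sq_eq_zero hα (p := v 0) (q := v 1) (by
      simp only [weightedSumSquares_apply, Fin.sum_univ_two, Matrix.cons_val, smul_eq_mul] at hv
      linear_combination hv)
    ext i
    fin_cases i <;> assumption
  obtain ⟨R, S, hR, hS, hRS⟩ := exists_orthogonal haniso (w := ![r, s]) (a := q) (b := p) (by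
    rw [← hrs]
    simp only [weightedSumSquares_apply, Fin.sum_univ_two, Matrix.cons_val, Algebra.smul_def,
      map_one, map_neg]
    ring)
  rw [polar_weightedSumSquares] at hRS
  simp only [weightedSumSquares_apply, Fin.sum_univ_two, Matrix.cons_val, smul_eq_mul] at hR hS hRS
  have h0 : R 0 * S 0 - α * (R 1 * S 1) = 0 :=
    (mul_eq_zero_iff_left (two_ne_zero (α := K))).1 (by linear_combination hRS)
  refine ⟨R 0 * S 1 - R 1 * S 0, ?_⟩
  rw [← hR, ← hS]
  linear_combination (R 0 * S 0 - α * (R 1 * S 1)) * h0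

theorem IsNonsplit.anisotropic_quadricRadicand [NeZero (2 : K)] (h : IsNonsplit A B) (ha : a ≠ 0)
    (hb : b ≠ 0) (hd : ¬IsSquare d) :
    (weightedSumSquares (QuadricFunctionField a b d)
      (normCoeffs (algebraMap K (RatFunc (RatFunc K)) A)
        (algebraMap K (RatFunc (RatFunc K)) B))).Anisotropic := by
  by_contra hsplit
  have hd0 : d ≠ 0 := fun h0 => hd (h0 ▸ IsSquare.zero)
  have had : a * d ≠ 0 := mul_ne_zero ha hd0
  obtain ⟨w, hw⟩ := h.ratFunc.ratFunc.exists_pure_eq_of_not_anisotropic hsplit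
  rw [weightedSumSquares_pureCoeffs_algebraMap] at hw
  obtain ⟨P, Q, hP, hQ, hPQ⟩ := exists_orthogonal h.ratFunc.anisotropic_pure hw
  have hsq (t : K) : t ^ 2 ≠ a * d := by
    intro ht
    rw [← ht, map_pow] at hQ
    have ht0 := (_root_.map_eq_zero _).1 (h.ratFunc.eq_zero_of_pure_eq_sq hQ).1
    exact had (by rw [← ht, ht0, zero_pow two_ne_zero])
  rw [weightedSumSquares_pureCoeffs_algebraMap] at hP hQ hPQ
  obtain ⟨γ, hγ, r, s, hrs⟩ := h.exists_norm_of_orthogonal had hP hQ hPQ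
  obtain ⟨t, ht⟩ := exists_mul_eq_of_norm_eq (p := γ * b) (q := γ * -(a * b)) hsq (by
    rw [hrs, map_mul, map_mul]
    ring)
  have hdt : d * t ^ 2 = (γ * b) ^ 2 := mul_left_cancel₀ ha (by linear_combination ht)
  have ht0 : t ≠ 0 := by
    rintro rfl
    exact pow_ne_zero 2 (mul_ne_zero hγ hb) (by rw [← hdt, zero_pow two_ne_zero, mul_zero])
  exact hd ⟨γ * b / t, by field_simp; linear_combination hdt⟩

end Quadric

section Embedding

theorem infinite_of_isTranscendenceBasis {K Ω ι : Type*} [Field K] [Countable K] [Field Ω]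
    [IsAlgClosed Ω] [Uncountable Ω] [Algebra K Ω] {x : ι → Ω} (hx : IsTranscendenceBasis K x) :
    Infinite ι := by
  by_contra hfin
  have := not_infinite_iff_finite.1 hfin
  have hcard := (IsAlgClosed.cardinal_le_max_transcendence_basis x hx).trans
    (max_le (max_le (Cardinal.lift_le_aleph0.2 Cardinal.mk_le_aleph0)
      (Cardinal.lift_le_aleph0.2 Cardinal.mk_le_aleph0)) le_rfl)
  exact not_countable (α := Ω) (Cardinal.mk_le_aleph0_iff.1 (Cardinal.lift_le_aleph0.1 hcard))

theorem nonempty_algHom_of_countable (K L Ω : Type*) [Field K] [Field L] [Countable L] [Field Ω]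
    [IsAlgClosed Ω] [Uncountable Ω] [Algebra K L] [Algebra K Ω] : Nonempty (L →ₐ[K] Ω) := by
  have : Countable K := (algebraMap K L).injective.countable
  obtain ⟨s, hs⟩ := exists_isTranscendenceBasis K L
  obtain ⟨t, ht⟩ := exists_isTranscendenceBasis K Ω
  have := infinite_of_isTranscendenceBasis ht
  obtain ⟨g, hg⟩ := exists_injective_nat s
  let ψ : Algebra.adjoin K (Set.range ((↑) : s → L)) →ₐ[K] Ω :=
    (MvPolynomial.aeval (R := K) fun i => (Infinite.natEmbedding t (g i) : Ω)).comp
      hs.1.aevalEquiv.symm.toAlgHom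
  have hψ : Function.Injective ψ :=
    (algebraicIndependent_iff_injective_aeval.1
      (ht.1.comp _ ((Infinite.natEmbedding t).injective.comp hg))).comp
      hs.1.aevalEquiv.symm.injective
  let _ := ψ.toAlgebra
  have := IsScalarTower.of_algHom ψ
  have := (faithfulSMul_iff_algebraMap_injective _ _).2 hψ
  have := hs.isAlgebraic
  exact ⟨(IsAlgClosed.lift (R := Algebra.adjoin K (Set.range ((↑) : s → L)))).restrictScalars K⟩

instance {K : Type*} [Field K] [Countable K] : Countable (RatFunc K) := by
  rw [← Cardinal.mk_le_aleph0_iff, IsFractionRing.cardinalMk (Polynomial K) (RatFunc K)]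
  exact Polynomial.cardinalMk_le_max.trans (max_le Cardinal.mk_le_aleph0 le_rfl)

end Embedding

section PreservesNonsplit

/-- Division quaternion algebras over `K` remain division algebras over `L`. -/
def PreservesNonsplit (K L : Type*) [Field K] [Field L] [Algebra K L] : Prop :=
  ∀ ⦃a b : K⦄, IsNonsplit a b → IsNonsplit (algebraMap K L a) (algebraMap K L b)

variable {K L E : Type*} [Field K] [Field L] [Field E] [Algebra K L] [Algebra K E]

theorem PreservesNonsplit.of_algHom (h : PreservesNonsplit K L) (f : E →ₐ[K] L) :
    PreservesNonsplit K E := fun a b hab => isNonsplit_algebraMap_iff.2 fun v hv => by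
  have hfv : f ∘ v = 0 := isNonsplit_algebraMap_iff.1 (h hab) _ (by
    rw [weightedSumSquares_comp_algHom, hv, map_zero])
  exact funext fun i => f.injective (by rw [Pi.zero_apply, map_zero]; exact congrFun hfv i)

theorem weightedSumSquares_pureCoeffs_quadric {a b d s v y : K} (ha : a ≠ 0) (hy : y ≠ 0)
    (hs : s ^ 2 = b + -(a * b) * v ^ 2 + a * d * y ^ 2) :
    weightedSumSquares K (pureCoeffs a b) ![s / (a * y), v / y, 1 / (a * y)] = d := by
  simp only [weightedSumSquares_apply, pureCoeffs, Fin.sum_univ_three, Matrix.cons_val, smul_eq_mul]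
  field_simp
  linear_combination hs

section FunctionField

variable {a b d : K} [Fact (∀ r, r ^ 2 ≠ quadricRadicand a b d + 0 * r)]

theorem preservesNonsplit_quadricFunctionField [NeZero (2 : K)] (ha : a ≠ 0) (hb : b ≠ 0)
    (hd : ¬IsSquare d) : PreservesNonsplit K (QuadricFunctionField a b d) := fun A B h => by
  rw [isNonsplit_iff_anisotropic,
    IsScalarTower.algebraMap_apply K (RatFunc (RatFunc K)) (QuadricFunctionField a b d),
    IsScalarTower.algebraMap_apply K (RatFunc (RatFunc K)) (QuadricFunctionField a b d),
    weightedSumSquares_normCoeffs_algebraMap]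
  exact h.anisotropic_quadricRadicand ha hb hd

theorem exists_pure_eq_quadricFunctionField (ha : a ≠ 0) :
    ∃ w, weightedSumSquares (QuadricFunctionField a b d) (pureCoeffs a b) w =
      algebraMap K (QuadricFunctionField a b d) d := by
  have hs := congrArg (algebraMap (RatFunc (RatFunc K)) (QuadricFunctionField a b d))
    (quadricRadicand.eq_1 a b d)
  have homega : algebraMap _ (QuadricFunctionField a b d) (quadricRadicand a b d) =
      QuadraticAlgebra.omega ^ 2 := by
    rw [pow_two, QuadraticAlgebra.omega_mul_omega_eq_mk]
    rfl
  simp only [homega, map_add, map_mul, map_pow, map_neg, ← IsScalarTower.algebraMap_apply] at hs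
  rw [← weightedSumSquares_pureCoeffs_algebraMap]
  exact ⟨_, weightedSumSquares_pureCoeffs_quadric ((_root_.map_ne_zero _).2 ha)
    ((_root_.map_ne_zero _).2 RatFunc.X_ne_zero) hs⟩

end FunctionField

theorem exists_intermediateField_represents {Ω : Type*} [NeZero (2 : K)] [Countable K] [Field Ω]
    [IsAlgClosed Ω] [Uncountable Ω] [Algebra K Ω] {a b d : K} (ha : a ≠ 0) (hb : b ≠ 0)
    (hd : ¬IsSquare d) :
    ∃ E : IntermediateField K Ω, Countable E ∧ PreservesNonsplit K E ∧
      ∃ w, weightedSumSquares E (pureCoeffs a b) w = algebraMap K E d := by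
  have hd0 : d ≠ 0 := fun h0 => hd (h0 ▸ IsSquare.zero)
  have : Fact (∀ r, r ^ 2 ≠ quadricRadicand a b d + 0 * r) :=
    ⟨fun r => by rw [zero_mul, add_zero]; exact sq_ne_quadricRadicand ha hb hd0 r⟩
  have : Countable (QuadricFunctionField a b d) :=
    (QuadraticAlgebra.equivProd _ _).injective.countable
  obtain ⟨φ⟩ := nonempty_algHom_of_countable K (QuadricFunctionField a b d) Ω
  let e := AlgEquiv.ofInjectiveField φ
  obtain ⟨w, hw⟩ := exists_pure_eq_quadricFunctionField (b := b) (d := d) ha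
  refine ⟨φ.fieldRange, e.symm.injective.countable,
    (preservesNonsplit_quadricFunctionField ha hb hd).of_algHom e.symm.toAlgHom, e ∘ w, ?_⟩
  exact (weightedSumSquares_comp_algHom e.toAlgHom _ w).trans (by rw [hw]; exact e.commutes d)

end PreservesNonsplit

section Closure

variable {X ι : Type*} {P : X → Prop}

theorem exists_monotone_seq [Preorder X] {R : ℕ → X → X → Prop}
    (step : ∀ n x, P x → ∃ y, x ≤ y ∧ P y ∧ R n x y) {x : X} (hx : P x) :
    ∃ F : ℕ →o X, F 0 = x ∧ (∀ n, P (F n)) ∧ ∀ n, R n (F n) (F (n + 1)) := by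
  choose next hle hP hR using fun n (y : {y // P y}) => step n y y.2
  let F (n : ℕ) : {y // P y} := Nat.rec ⟨x, hx⟩ (fun n y => ⟨next n y, hP n y⟩) n
  exact ⟨⟨fun n => (F n).1, monotone_nat_of_le_succ fun n => hle n (F n)⟩, rfl, fun n => (F n).2,
    fun n => hR n (F n)⟩

variable [CompleteLattice X] {R : ι → X → Prop}

theorem exists_ge_forall_mem_countable
    (iSup_mem : ∀ F : ℕ →o X, (∀ n, P (F n)) → P (⨆ n, F n)) (mono : ∀ t, Monotone (R t))
    {S : Set ι} (hS : S.Countable) {x : X} (hx : P x)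
    (step : ∀ t ∈ S, ∀ y, x ≤ y → P y → ∃ z, y ≤ z ∧ P z ∧ R t z) :
    ∃ y, x ≤ y ∧ P y ∧ ∀ t ∈ S, R t y := by
  obtain rfl | hne := S.eq_empty_or_nonempty
  · exact ⟨x, le_rfl, hx, fun t ht => ht.elim⟩
  obtain ⟨f, rfl⟩ := hS.exists_eq_range hne
  obtain ⟨F, hF0, hF, hR⟩ := exists_monotone_seq (P := fun y => x ≤ y ∧ P y)
    (R := fun n _ y => R (f n) y) (fun n y hy => by
      obtain ⟨z, hyz, hz, hRz⟩ := step (f n) ⟨n, rfl⟩ y hy.1 hy.2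
      exact ⟨z, hyz, ⟨hy.1.trans hyz, hz⟩, hRz⟩) ⟨le_rfl, hx⟩
  refine ⟨⨆ n, F n, hF0 ▸ le_iSup F 0, iSup_mem F fun n => (hF n).2, ?_⟩
  rintro _ ⟨n, rfl⟩
  exact mono _ (le_iSup F (n + 1)) (hR n)

/- Only countably many tasks are known at each stage; carrying them out creates new ones, so the
preceding construction is iterated `ω` times. -/
theorem exists_ge_forall_mem
    (iSup_mem : ∀ F : ℕ →o X, (∀ n, P (F n)) → P (⨆ n, F n)) (mono : ∀ t, Monotone (R t))
    {T : X → Set ι} (hT : Monotone T) (countable : ∀ y, P y → (T y).Countable)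
    (T_iSup : ∀ F : ℕ →o X, T (⨆ n, F n) ⊆ ⋃ n, T (F n))
    (step : ∀ y, P y → ∀ t ∈ T y, ∃ z, y ≤ z ∧ P z ∧ R t z) {x : X} (hx : P x) :
    ∃ y, x ≤ y ∧ P y ∧ ∀ t ∈ T y, R t y := by
  obtain ⟨F, hF0, hF, hR⟩ := exists_monotone_seq (R := fun _ y z => ∀ t ∈ T y, R t z)
    (fun _ y hy => exists_ge_forall_mem_countable iSup_mem mono (countable y hy) hy
      fun t ht z hyz hz => step z hz t (hT hyz ht)) hx
  refine ⟨⨆ n, F n, hF0 ▸ le_iSup F 0, iSup_mem F hF, fun t ht => ?_⟩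
  obtain ⟨n, hn⟩ := Set.mem_iUnion.1 (T_iSup F ht)
  exact mono t (le_iSup F (n + 1)) (hR n t hn)

end Closure

section Construction

variable {k Ω : Type*} [Field k] [Field Ω] [Algebra k Ω]

theorem exists_forall_mem_of_forall_mem_iSup (F : ℕ →o IntermediateField k Ω) {ι : Type*}
    [Finite ι] {v : ι → Ω} (hv : ∀ i, v i ∈ ⨆ n, F n) : ∃ n, ∀ i, v i ∈ F n := by
  simp only [← SetLike.mem_coe, IntermediateField.coe_iSup_of_directed F.monotone.directed_le,
    Set.mem_iUnion] at hv
  choose n hn using hv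
  obtain ⟨m, hm⟩ := Finite.exists_le n
  exact ⟨m, fun i => F.monotone (hm i) (hn i)⟩

theorem countable_iSup (F : ℕ →o IntermediateField k Ω) (hF : ∀ n, Countable (F n)) :
    Countable (⨆ n, F n : IntermediateField k Ω) := by
  rw [← SetLike.coe_sort_coe, IntermediateField.coe_iSup_of_directed F.monotone.directed_le]
  exact (Set.countable_iUnion fun n => (hF n).to_set).to_subtype

theorem preservesNonsplit_intermediateField_iff {E : IntermediateField k Ω} :
    PreservesNonsplit k E ↔ ∀ ⦃a b : k⦄, IsNonsplit a b → ∀ v : Fin 4 → Ω, (∀ i, v i ∈ E) →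
      weightedSumSquares Ω (normCoeffs a b) v = 0 → v = 0 := by
  refine forall₃_congr fun a b _ => isNonsplit_algebraMap_iff.trans ⟨fun h v hvE hv => ?_,
    fun h v hv => ?_⟩
  · have hzero : (fun i => (⟨v i, hvE i⟩ : E)) = 0 := h _ (Subtype.val_injective (by
      exact (weightedSumSquares_comp_algHom E.val _ fun i => ⟨v i, hvE i⟩).symm.trans hv))
    exact funext fun i => congrArg Subtype.val (congrFun hzero i)
  · have hzero := h (E.val ∘ v) (fun i => (v i).2) (by
      rw [weightedSumSquares_comp_algHom, hv, map_zero])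
    exact funext fun i => Subtype.ext (congrFun hzero i)

theorem preservesNonsplit_iSup (F : ℕ →o IntermediateField k Ω)
    (hF : ∀ n, PreservesNonsplit k (F n)) :
    PreservesNonsplit k (⨆ n, F n : IntermediateField k Ω) := by
  refine preservesNonsplit_intermediateField_iff.2 fun a b hab v hvF hv => ?_
  obtain ⟨n, hn⟩ := exists_forall_mem_of_forall_mem_iSup F hvF
  exact preservesNonsplit_intermediateField_iff.1 (hF n) hab v hn hv

theorem preservesNonsplit_bot : PreservesNonsplit k (⊥ : IntermediateField k Ω) :=
  PreservesNonsplit.of_algHom (L := k) (fun _ _ h => h)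
    (IntermediateField.botEquiv k Ω).toAlgHom

/-- For `t = ![a, b, d]` with `a, b ≠ 0`: if `d` is not a square in `E`, then `E(√d)` embeds into
`(a, b / E)`. The coefficients live in `Ω` so that the condition makes sense for all `E`. -/
def SquareOrRepresented (t : Fin 3 → Ω) (E : IntermediateField k Ω) : Prop :=
  t 0 ≠ 0 → t 1 ≠ 0 → (∃ r ∈ E, r * r = t 2) ∨
    ∃ w : Fin 3 → Ω, (∀ i, w i ∈ E) ∧ weightedSumSquares Ω (pureCoeffs (t 0) (t 1)) w = t 2

theorem SquareOrRepresented.monotone (t : Fin 3 → Ω) :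
    Monotone (SquareOrRepresented (k := k) t) := fun _ _ hle h ha hb =>
  (h ha hb).imp (fun ⟨r, hr, hrt⟩ => ⟨r, hle hr, hrt⟩)
    fun ⟨w, hw, hwt⟩ => ⟨w, fun i => hle (hw i), hwt⟩

theorem weightedSumSquares_pureCoeffs_coe {E : IntermediateField k Ω} {a b : E} (w : Fin 3 → E) :
    weightedSumSquares Ω (pureCoeffs (a : Ω) (b : Ω)) (fun i => (w i : Ω)) =
      weightedSumSquares E (pureCoeffs a b) w := by
  rw [← E.algebraMap_apply a, ← E.algebraMap_apply b, weightedSumSquares_pureCoeffs_algebraMap]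
  exact weightedSumSquares_comp_algebraMap Ω w

theorem PreservesNonsplit.exists_squareOrRepresented [NeZero (2 : k)] [IsAlgClosed Ω]
    [Uncountable Ω] {E : IntermediateField k Ω} [Countable E] (hE : PreservesNonsplit k E)
    {t : Fin 3 → Ω} (ht : ∀ i, t i ∈ E) :
    ∃ E' : IntermediateField k Ω, E ≤ E' ∧ (Countable E' ∧ PreservesNonsplit k E') ∧
      SquareOrRepresented t E' := by
  by_cases h : (t 0 = 0 ∨ t 1 = 0) ∨ ∃ r ∈ E, r * r = t 2
  · refine ⟨E, le_rfl, ⟨inferInstance, hE⟩, fun ha hb => Or.inl (h.resolve_left ?_)⟩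
    exact not_or_intro ha hb
  simp only [not_or] at h
  obtain ⟨⟨ha, hb⟩, hd⟩ := h
  have : NeZero (2 : E) := ⟨by
    rw [← map_ofNat (algebraMap k E) 2]
    exact (_root_.map_ne_zero _).2 two_ne_zero⟩
  let a : E := ⟨t 0, ht 0⟩
  let b : E := ⟨t 1, ht 1⟩
  let d : E := ⟨t 2, ht 2⟩
  obtain ⟨L, hL, hEL, w, hw⟩ := exists_intermediateField_represents (Ω := Ω) (a := a) (b := b)
    (d := d) (fun h => ha (congrArg Subtype.val h)) (fun h => hb (congrArg Subtype.val h))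
    (fun ⟨r, hr⟩ => hd ⟨r, r.2, (congrArg Subtype.val hr).symm⟩)
  refine ⟨L.restrictScalars k, fun x hx => L.algebraMap_mem ⟨x, hx⟩,
    ⟨hL, fun _ _ hab => hEL (hE hab)⟩,
    fun _ _ => Or.inr ⟨L.val ∘ w, fun i => (w i).2, ?_⟩⟩
  calc weightedSumSquares Ω (pureCoeffs (algebraMap E Ω a) (algebraMap E Ω b)) (L.val ∘ w)
      = L.val (weightedSumSquares L (pureCoeffs a b) w) := by
        rw [weightedSumSquares_pureCoeffs_algebraMap, weightedSumSquares_comp_algHom]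
    _ = t 2 := by rw [hw]; rfl

theorem exists_intermediateField_pure_represents (k Ω : Type*) [Field k] [NeZero (2 : k)]
    [Countable k] [Field Ω] [IsAlgClosed Ω] [Uncountable Ω] [Algebra k Ω] :
    ∃ E : IntermediateField k Ω, PreservesNonsplit k E ∧
      ∀ a b d : E, a ≠ 0 → b ≠ 0 → ¬IsSquare d →
        ∃ w, weightedSumSquares E (pureCoeffs a b) w = d := by
  obtain ⟨E, -, ⟨-, hE⟩, hrep⟩ := exists_ge_forall_mem
    (P := fun E : IntermediateField k Ω => Countable E ∧ PreservesNonsplit k E)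
    (R := SquareOrRepresented) (T := fun E => {t | ∀ i, t i ∈ E}) (x := ⊥)
    (fun F hF => ⟨countable_iSup F fun n => (hF n).1, preservesNonsplit_iSup F fun n => (hF n).2⟩)
    SquareOrRepresented.monotone (fun _ _ hle _ ht i => hle (ht i))
    (fun E hE => Set.countable_pi fun _ => hE.1.to_set)
    (fun F _ ht => Set.mem_iUnion.2 (exists_forall_mem_of_forall_mem_iSup F ht))
    (fun E ⟨_, hE⟩ _ ht => hE.exists_squareOrRepresented ht)
    ⟨(IntermediateField.botEquiv k Ω).injective.countable, preservesNonsplit_bot⟩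
  refine ⟨E, hE, fun a b d ha hb hd => ?_⟩
  obtain ⟨r, hrE, hr⟩ | ⟨w, hwE, hw⟩ := hrep ![a, b, d]
    (fun i => by fin_cases i; exacts [a.2, b.2, d.2])
    (fun h => ha (Subtype.ext h)) (fun h => hb (Subtype.ext h))
  · exact (hd ⟨⟨r, hrE⟩, Subtype.ext hr.symm⟩).elim
  · exact ⟨fun i => ⟨w i, hwE i⟩,
      Subtype.ext ((weightedSumSquares_pureCoeffs_coe _).symm.trans hw)⟩

end Construction

section RationalNumbers

theorem isNonsplit_neg_one_of_odd_padicValNat {n p : ℕ} (hp : p.Prime) (hp4 : p % 4 = 3)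
    (hodd : Odd (padicValNat p n)) : IsNonsplit (-1 : ℚ) n := by
  refine isNonsplit_of_ne_sq_sub_mul_sq (fun r => by nlinarith only [sq_nonneg r])
    fun u v huv => ?_
  have := Fact.mk hp
  have hn : n ≠ 0 := by
    rintro rfl
    rw [padicValNat_zero_right] at hodd
    exact Nat.not_odd_zero hodd
  have hden : u.den * v.den ≠ 0 := mul_ne_zero u.den_ne_zero v.den_ne_zero
  have hsum : n * (u.den * v.den) ^ 2 =
      (u.num * v.den).natAbs ^ 2 + (v.num * u.den).natAbs ^ 2 := by
    zify
    simp only [sq_abs]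
    have hcast : (n * (u.den * v.den) ^ 2 : ℚ) = (u.num * v.den) ^ 2 + (v.num * u.den) ^ 2 := by
      rw [← Rat.mul_den_eq_num u, ← Rat.mul_den_eq_num v, huv]
      ring
    exact_mod_cast hcast
  have hdvd : p ∣ n * (u.den * v.den) ^ 2 := (dvd_of_one_le_padicValNat hodd.pos).mul_right _
  have heven : Even (padicValNat p (n * (u.den * v.den) ^ 2)) :=
    Nat.eq_sq_add_sq_iff.1 ⟨_, _, hsum⟩ p
      (Nat.mem_primeFactors.2 ⟨hp, hdvd, mul_ne_zero hn (pow_ne_zero 2 hden)⟩) hp4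
  rw [padicValNat.mul hn (pow_ne_zero 2 hden), padicValNat.pow] at heven
  exact Nat.not_even_iff_odd.2 (hodd.add_even (even_two_mul _)) heven

end RationalNumbers

section MaximalSubfields

variable {K D D' : Type*} [Field K] [DivisionRing D] [Algebra K D] [DivisionRing D']
  [Algebra K D'] {d : K} {θ : D}

/-- The homomorphism from `K(√d)` that sends `√d` to a given square root `θ` of `d`. -/
def sqrtHom (hθ : θ * θ = algebraMap K D d) : QuadraticAlgebra K d 0 →ₐ[K] D :=
  QuadraticAlgebra.lift
    ⟨θ, by rw [hθ, Algebra.algebraMap_eq_smul_one, zero_smul, add_zero]⟩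

theorem sqrtHom_apply (hθ : θ * θ = algebraMap K D d) (z : QuadraticAlgebra K d 0) :
    sqrtHom hθ z = algebraMap K D z.re + z.im • θ := by
  rw [Algebra.algebraMap_eq_smul_one]
  rfl

theorem mem_range_sqrtHom (hθ : θ * θ = algebraMap K D d) {x : D} :
    x ∈ (sqrtHom hθ).range ↔ ∃ r s : K, x = algebraMap K D r + s • θ :=
  ⟨fun ⟨z, hz⟩ => ⟨z.re, z.im, hz.symm.trans (sqrtHom_apply hθ z)⟩,
    fun ⟨r, s, hx⟩ => ⟨⟨r, s⟩, (sqrtHom_apply hθ _).trans hx.symm⟩⟩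

theorem range_sqrtHom_le (hθ : θ * θ = algebraMap K D d) {E : Subalgebra K D} (hE : θ ∈ E) :
    (sqrtHom hθ).range ≤ E := fun x hx => by
  obtain ⟨r, s, rfl⟩ := (mem_range_sqrtHom hθ).1 hx
  exact add_mem (E.algebraMap_mem r) (E.smul_mem hE s)

theorem notMem_range_algebraMap_of_not_isSquare (hd : ¬IsSquare d)
    (hθ : θ * θ = algebraMap K D d) : θ ∉ Set.range (algebraMap K D) := by
  rintro ⟨r, rfl⟩
  exact hd ⟨r, (algebraMap K D).injective (by rw [← hθ, map_mul])⟩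

theorem not_isSquare_of_notMem_range_algebraMap (hmem : θ ∉ Set.range (algebraMap K D))
    (hθ : θ * θ = algebraMap K D d) : ¬IsSquare d := by
  rintro ⟨s, rfl⟩
  rw [map_mul, (show Commute θ (algebraMap K D s) from
    (Algebra.commutes s θ).symm).mul_self_eq_mul_self_iff] at hθ
  obtain rfl | rfl := hθ
  · exact hmem ⟨s, rfl⟩
  · exact hmem ⟨-s, map_neg _ s⟩

theorem fact_ne_add_zero_mul_of_not_isSquare (hd : ¬IsSquare d) :
    Fact (∀ r, r ^ 2 ≠ d + 0 * r) :=
  ⟨fun r hr => hd ⟨r, by rw [← sq, hr, zero_mul, add_zero]⟩⟩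

theorem nonempty_algEquiv_range_sqrtHom (hd : ¬IsSquare d) (hθ : θ * θ = algebraMap K D d) :
    Nonempty (QuadraticAlgebra K d 0 ≃ₐ[K] (sqrtHom hθ).range) := by
  have := fact_ne_add_zero_mul_of_not_isSquare hd
  exact ⟨AlgEquiv.ofInjective _ (sqrtHom hθ).toRingHom.injective⟩

theorem isField_range_sqrtHom (hd : ¬IsSquare d) (hθ : θ * θ = algebraMap K D d) :
    IsField (sqrtHom hθ).range := by
  have := fact_ne_add_zero_mul_of_not_isSquare hd
  obtain ⟨e⟩ := nonempty_algEquiv_range_sqrtHom hd hθ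
  exact e.symm.toMulEquiv.isField (Field.toIsField _)

theorem IsQuaternionAlgebra.isMaximalSubfield_range_sqrtHom [NeZero (2 : K)]
    (hD : IsQuaternionAlgebra K D) (hd : ¬IsSquare d) (hθ : θ * θ = algebraMap K D d) :
    IsMaximalSubfield K (sqrtHom hθ).range := by
  refine ⟨isField_range_sqrtHom hd hθ, fun F hF hle x hx => ?_⟩
  have hθF : θ ∈ F := hle ((mem_range_sqrtHom hθ).2 ⟨0, 1, by simp⟩)
  exact (mem_range_sqrtHom hθ).2 (hD.exists_eq_add_smul_of_commute
    (notMem_range_algebraMap_of_not_isSquare hd hθ)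
    (congrArg Subtype.val (hF.mul_comm ⟨θ, hθF⟩ ⟨x, hx⟩)))

theorem IsQuaternionAlgebra.exists_sub_mul_self_eq [NeZero (2 : K)]
    (hD : IsQuaternionAlgebra K D) (x : D) :
    ∃ r d : K, (x - algebraMap K D r) * (x - algebraMap K D r) = algebraMap K D d := by
  obtain ⟨t, n, hx⟩ := hD.exists_mul_self_eq x
  refine ⟨t / 2, n + t / 2 * (t / 2), ?_⟩
  have hhalf : algebraMap K D t = algebraMap K D (t / 2) + algebraMap K D (t / 2) := by
    rw [← map_add, add_halves]
  rw [sub_mul, mul_sub, mul_sub, ← Algebra.commutes, hx, Algebra.smul_def, hhalf, map_add, map_mul,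
    add_mul]
  abel

theorem IsQuaternionAlgebra.exists_notMem_range_algebraMap (hD : IsQuaternionAlgebra K D) :
    ∃ x : D, x ∉ Set.range (algebraMap K D) := by
  obtain ⟨a, b, -, -, ⟨e⟩⟩ := hD
  refine ⟨e.symm ⟨0, 1, 0, 0⟩, fun ⟨r, hr⟩ => ?_⟩
  rw [e.eq_symm_apply, e.commutes] at hr
  exact zero_ne_one (congrArg QuaternionAlgebra.imI hr)

theorem IsQuaternionAlgebra.exists_mem_range_sqrtHom [NeZero (2 : K)]
    (hD : IsQuaternionAlgebra K D) {x : D} (hx : x ∉ Set.range (algebraMap K D)) :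
    ∃ (d : K) (θ : D) (hθ : θ * θ = algebraMap K D d), ¬IsSquare d ∧ x ∈ (sqrtHom hθ).range ∧
      ∀ E : Subalgebra K D, x ∈ E → (sqrtHom hθ).range ≤ E := by
  obtain ⟨r, d, hθ⟩ := hD.exists_sub_mul_self_eq x
  refine ⟨d, _, hθ, not_isSquare_of_notMem_range_algebraMap (fun ⟨s, hs⟩ => hx ⟨s + r, ?_⟩) hθ,
    (mem_range_sqrtHom hθ).2 ⟨r, 1, by rw [one_smul, add_sub_cancel]⟩,
    fun E hE => range_sqrtHom_le hθ (sub_mem hE (E.algebraMap_mem r))⟩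
  rw [map_add, hs, sub_add_cancel]

theorem IsQuaternionAlgebra.exists_mem_notMem_of_isMaximalSubfield [NeZero (2 : K)]
    (hD : IsQuaternionAlgebra K D) {E : Subalgebra K D} (hE : IsMaximalSubfield K E) :
    ∃ x ∈ E, x ∉ Set.range (algebraMap K D) := by
  by_contra! hE_le
  obtain ⟨x, hx⟩ := hD.exists_notMem_range_algebraMap
  obtain ⟨d, θ, hθ, hd, hxθ, -⟩ := hD.exists_mem_range_sqrtHom hx
  have hle : E ≤ (sqrtHom hθ).range := fun y hy => by
    obtain ⟨r, rfl⟩ := hE_le y hy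
    exact Subalgebra.algebraMap_mem _ r
  exact hx (hE_le x (hE.2 (isField_range_sqrtHom hd hθ) hle hxθ))

theorem IsQuaternionAlgebra.exists_eq_range_sqrtHom [NeZero (2 : K)]
    (hD : IsQuaternionAlgebra K D) {E : Subalgebra K D} (hE : IsMaximalSubfield K E) :
    ∃ (d : K) (θ : D) (hθ : θ * θ = algebraMap K D d), ¬IsSquare d ∧ E = (sqrtHom hθ).range := by
  obtain ⟨x, hxE, hx⟩ := hD.exists_mem_notMem_of_isMaximalSubfield hE
  obtain ⟨d, θ, hθ, hd, -, hle⟩ := hD.exists_mem_range_sqrtHom hx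
  exact ⟨d, θ, hθ, hd, ((hD.isMaximalSubfield_range_sqrtHom hd hθ).eq_of_le hE.prop
    (hle E hxE)).symm⟩

theorem IsQuaternionAlgebra.exists_isMaximalSubfield_algEquiv [NeZero (2 : K)]
    (hD : IsQuaternionAlgebra K D) (hD' : IsQuaternionAlgebra K D')
    (hsqrt : ∀ d : K, ¬IsSquare d → ∃ θ : D', θ * θ = algebraMap K D' d)
    {E : Subalgebra K D} (hE : IsMaximalSubfield K E) :
    ∃ E' : Subalgebra K D', IsMaximalSubfield K E' ∧ Nonempty (E ≃ₐ[K] E') := by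
  obtain ⟨d, θ, hθ, hd, rfl⟩ := hD.exists_eq_range_sqrtHom hE
  obtain ⟨θ', hθ'⟩ := hsqrt d hd
  obtain ⟨e⟩ := nonempty_algEquiv_range_sqrtHom hd hθ
  obtain ⟨e'⟩ := nonempty_algEquiv_range_sqrtHom hd hθ'
  exact ⟨_, hD'.isMaximalSubfield_range_sqrtHom hd hθ', ⟨e.symm.trans e'⟩⟩

theorem IsQuaternionAlgebra.exists_mul_self_eq_algebraMap (hD : IsQuaternionAlgebra K D)
    (hrep : ∀ a b : K, a ≠ 0 → b ≠ 0 → ∃ w, weightedSumSquares K (pureCoeffs a b) w = d) :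
    ∃ θ : D, θ * θ = algebraMap K D d := by
  obtain ⟨a, b, ha, hb, ⟨e⟩⟩ := hD
  obtain ⟨w, hw⟩ := hrep a b ha hb
  exact ⟨e.symm (pureQuaternion a b w), by
    rw [← map_mul, pureQuaternion_mul_self, hw, e.symm.commutes]⟩

theorem IsQuaternionAlgebra.weaklyIsomorphic [NeZero (2 : K)] (hD : IsQuaternionAlgebra K D)
    (hD' : IsQuaternionAlgebra K D')
    (hrep : ∀ a b d : K, a ≠ 0 → b ≠ 0 → ¬IsSquare d →
      ∃ w, weightedSumSquares K (pureCoeffs a b) w = d) :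
    WeaklyIsomorphic K D D' := by
  have hsqrt {d : K} (hd : ¬IsSquare d) (a b : K) (ha : a ≠ 0) (hb : b ≠ 0) :=
    hrep a b d ha hb hd
  refine ⟨fun E hE => hD.exists_isMaximalSubfield_algEquiv hD'
    (fun d hd => hD'.exists_mul_self_eq_algebraMap (hsqrt hd)) hE, fun E' hE' => ?_⟩
  obtain ⟨E, hE, ⟨e⟩⟩ := hD'.exists_isMaximalSubfield_algEquiv hD
    (fun d hd => hD.exists_mul_self_eq_algebraMap (hsqrt hd)) hE'
  exact ⟨E, hE, ⟨e.symm⟩⟩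

end MaximalSubfields

section QuatStar

theorem IsQuaternionAlgebra.exists_norm_eq_mul_of_algHom {K D : Type*} [Field K] [NeZero (2 : K)]
    [DivisionRing D] [Algebra K D] (hD : IsQuaternionAlgebra K D) {a b b' : K} (ha : a ≠ 0)
    (hb : b ≠ 0) (f : ℍ[K,a,b] →ₐ[K] D) (f' : ℍ[K,a,b'] →ₐ[K] D) :
    ∃ r s : K, r ^ 2 - a * s ^ 2 = b * b' := by
  have hi {c : K} (g : ℍ[K,a,c] →ₐ[K] D) :
      g ⟨0, 1, 0, 0⟩ * g ⟨0, 1, 0, 0⟩ = algebraMap K D a := by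
    rw [← map_mul, ← g.commutes]
    congr 1
    ext <;> simp
  have hj {c : K} (g : ℍ[K,a,c] →ₐ[K] D) :
      g ⟨0, 0, 1, 0⟩ * g ⟨0, 0, 1, 0⟩ = algebraMap K D c := by
    rw [← map_mul, ← g.commutes]
    congr 1
    ext <;> simp
  have hij {c : K} (g : ℍ[K,a,c] →ₐ[K] D) :
      g ⟨0, 1, 0, 0⟩ * g ⟨0, 0, 1, 0⟩ = -(g ⟨0, 0, 1, 0⟩ * g ⟨0, 1, 0, 0⟩) := by
    rw [← map_mul, ← map_mul, ← map_neg]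
    congr 1
    ext <;> simp
  exact hD.exists_norm_eq_mul (hi f) (hi f') (hj f) (hj f') ha hb (hij f) (hij f')

variable {K : Type} [Field K] {a b c : K}

/-- The quaternion division algebra `(a, b / K)`. -/
noncomputable def IsNonsplit.quatDivAlg (h : IsNonsplit a b) : QuatDivAlg K :=
  letI : DivisionRing ℍ[K,a,b] := .ofIsUnitOrEqZero fun x => or_iff_not_imp_right.2 (h x)
  { carrier := ℍ[K,a,b]
    algebra := QuaternionAlgebra.instAlgebra
    isQuaternionAlgebra := ⟨a, b, h.ne_zero.1, h.ne_zero.2, ⟨AlgEquiv.refl⟩⟩ }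

theorem IsNonsplit.not_equiv_quatDivAlg [NeZero (2 : K)] (hb : IsNonsplit a b)
    (hc : IsNonsplit a c) (hbc : IsNonsplit a (b * c)) : ¬hb.quatDivAlg ≈ hc.quatDivAlg := by
  rintro ⟨e⟩
  obtain ⟨r, s, hrs⟩ := hc.quatDivAlg.isQuaternionAlgebra.exists_norm_eq_mul_of_algHom
    hb.ne_zero.1 hb.ne_zero.2 e.toAlgHom (AlgHom.id K _)
  exact hbc.ne_sq_sub_mul_sq r s hrs.symm

theorem infinite_quatStar [Algebra ℚ K] (hK : PreservesNonsplit ℚ K) : Infinite (QuatStar K) := by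
  have := algebraRat.charZero K
  let S := {p : ℕ | p.Prime ∧ p ≡ 3 [MOD 4]}
  have : Infinite S :=
    (Nat.infinite_setOfPred_prime_and_modEq (by norm_num) (by norm_num)).to_subtype
  have hS (p : S) := hK (isNonsplit_neg_one_of_odd_padicValNat p.2.1 p.2.2 (n := p) (by
    have := Fact.mk p.2.1
    rw [padicValNat_self]
    exact odd_one))
  refine Infinite.of_injective (fun p : S => (⟦(hS p).quatDivAlg⟧ : QuatStar K)) fun p q hpq => ?_
  by_contra hne
  have hodd : Odd (padicValNat p (p * q)) := by
    have := Fact.mk p.2.1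
    have := Fact.mk q.2.1
    rw [padicValNat.mul p.2.1.ne_zero q.2.1.ne_zero, padicValNat_self,
      padicValNat_primes fun h => hne (Subtype.ext h)]
    exact odd_one
  have hpq_nonsplit := hK (isNonsplit_neg_one_of_odd_padicValNat p.2.1 p.2.2 hodd)
  rw [Nat.cast_mul, map_mul] at hpq_nonsplit
  exact (hS p).not_equiv_quatDivAlg (hS q) hpq_nonsplit (Quotient.exact hpq)

end QuatStar

theorem theoremC :
    ∃ (K : Type) (_ : Field K), ringChar K ≠ 2 ∧
      Infinite (QuatStar K) ∧
      ∀ D D' : QuatDivAlg K, WeaklyIsomorphic K D D' := by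
  have : Uncountable ℂ := Set.not_countable_univ_iff.1 not_countable_complex
  obtain ⟨K, hK, hrep⟩ := exists_intermediateField_pure_represents ℚ ℂ
  exact ⟨K, inferInstance, by rw [ringChar.eq_zero]; exact two_ne_zero.symm, infinite_quatStar hK,
    fun D D' => D.isQuaternionAlgebra.weaklyIsomorphic D'.isQuaternionAlgebra hrep⟩
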